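/- Let $r\ge 1$. An $r$-permutation of $[n]=\{1,\dots,n\}$ is a rearrangement $a_1a_2\cdots a_{rn}$ of the multiset $\{1^r,2^r,\dots,n^r\}$ such that $i<j<k$ and $a_i=a_k$ imply $a_j\le a_i$. The stack-sorting operation $S$ on words of positive integers is defined recursively by $S(\emptyset)=\emptyset$ and, if $m$ is the largest letter of a nonempty word $\pi=\alpha_1 m\alpha_2 m\cdots m\alpha_{j}$ (with $m$ not occurring in the possibly empty words $\alpha_i$), $S(\pi)=S(\alpha_1)S(\alpha_2)\cdots S(\alpha_{j})\,m$. An $r$-permutation $\pi$ of $[n]$ is two-stack-sortable if $S(S(\pi))=12\cdots n$. A two-stack-sortable $k$-tuple $r$-permutation of $[n]$ is a tuple $(\alpha_1,\dots,\alpha_k)$ of possibly empty words such that $\alpha_1\alpha_2\cdots\alpha_k$ is an $r$-permutation of $[n]$, every letter appears in only one of the $\alpha_i$, and $S(S(\alpha_1)S(\alpha_2)\cdots S(\alpha_k))=12\cdots n$. Let $p_k=\sum_{n\ge 0}p_n^{(k)}x^n$, where $p_n^{(k)}$ is the number of two-stack-sortable $k$-tuple $r$-permutations of $[n]$. Then $p_1$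 is the generating function $\sum_{n\ge0}a_nx^n$, where $a_n$ is the number of two-stack-sortable $r$-permutations of $[n]$ (the empty one included, $a_0=1$), and $$p_1=1+y-ry^2,$$ where $y$ is the formal power series in $x$ with rational coefficients that is uniquely determined by $x=\dfrac{y}{(1+y)^{2r+1}}$. -/

import Mathlib

namespace StackSort

/-- Cutting a word at all the occurrences of one of its letters leaves only shorter words. -/
theorem length_lt_of_mem_splitOn (m : ℕ) (w : List ℕ) :
    ∀ u ∈ w.splitOn m, u.length ≤ w.length ∧ (m ∈ w → u.length < w.length) := by
  induction w with
  | nil => simp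
  | cons a w ih =>
    intro u hu
    rw [List.splitOn_cons_eq_if_modifyHead] at hu
    by_cases ha : a = m
    · simp only [ha, BEq.rfl, if_true, List.mem_cons] at hu
      rcases hu with rfl | hu
      · simp
      · have := (ih u hu).1
        simp only [List.length_cons]
        exact ⟨by omega, fun _ => by omega⟩
    · simp only [beq_iff_eq, ha, if_false] at hu
      obtain ⟨v, vs, hv⟩ := List.exists_cons_of_ne_nil (List.splitOn_ne_nil m w)
      rw [hv] at hu ih
      simp only [List.modifyHead_cons, List.mem_cons] at hu
      have hm : m ∈ a :: w → m ∈ w := fun h => by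
        rcases List.mem_cons.1 h with h | h
        · exact absurd h.symm ha
        · exact h
      rcases hu with rfl | hu
      · have := ih v (by simp)
        simp only [List.length_cons]
        exact ⟨by omega, fun h => by have := this.2 (hm h); omega⟩
      · have := ih u (by simp [hu])
        simp only [List.length_cons]
        exact ⟨by omega, fun h => by have := this.2 (hm h); omega⟩

/-- The stack-sorting operation on words over `ℕ`. The empty word is sent to itself; if `m` is the
largest letter of `w` and `w = α₁ m α₂ m ⋯ m αₖ` where `m` does not occur in any of the (possibly
empty) words `αᵢ`, then `S(w) = S(α₁) S(α₂) ⋯ S(αₖ) m`. -/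
def S (w : List ℕ) : List ℕ :=
  if h : w = [] then []
  else ((w.splitOn (w.max h)).attach.map fun α => S α.1).flatten ++ [w.max h]
termination_by w.length
decreasing_by
  exact (length_lt_of_mem_splitOn _ _ _ α.2).2 (List.max_mem h)

theorem S_nil : S [] = [] := by
  rw [S]
  simp

theorem S_of_ne_nil (w : List ℕ) (h : w ≠ []) :
    S w = ((w.splitOn (w.max h)).map S).flatten ++ [w.max h] := by
  rw [S, dif_neg h]
  simp

/-- `w` is an `r`-permutation of `[n] = {1, …, n}`: a rearrangement of the multiset
`{1^r, 2^r, …, n^r}` in which all letters between two equal letters `a` are at most `a`. -/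
def IsRPerm (r n : ℕ) (w : List ℕ) : Prop :=
  (∀ a : ℕ, w.count a = if a ∈ Finset.Icc 1 n then r else 0) ∧
  ∀ i j k : Fin w.length, i < j → j < k → w.get i = w.get k → w.get j ≤ w.get i

/-- The identity permutation `1 2 ⋯ n` of `[n]`, as a word. -/
def identityWord (n : ℕ) : List ℕ := List.range' 1 n

/-- `w` is a two-stack-sortable `r`-permutation of `[n]`. -/
def IsTwoStackSortable (r n : ℕ) (w : List ℕ) : Prop :=
  IsRPerm r n w ∧ S (S w) = identityWord n

/-- `(α₁, …, αₖ)` is a `k`-tuple `r`-permutation of `[n]`: the concatenation `α₁ ⋯ αₖ` is an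
`r`-permutation of `[n]` and every letter appears in only one of the `αᵢ`, which may be empty. -/
def IsTupleRPerm (r n k : ℕ) (α : Fin k → List ℕ) : Prop :=
  IsRPerm r n (List.ofFn α).flatten ∧
  ∀ (a : ℕ) (i j : Fin k), a ∈ α i → a ∈ α j → i = j

/-- `(α₁, …, αₖ)` is a two-stack-sortable `k`-tuple `r`-permutation of `[n]`:
`S(S(α₁) S(α₂) ⋯ S(αₖ))` is the identity permutation. -/
def IsTwoStackSortableTuple (r n k : ℕ) (α : Fin k → List ℕ) : Prop :=
  IsTupleRPerm r n k α ∧ S (List.ofFn fun i => S (α i)).flatten = identityWord n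

/-- The generating function `p_k = ∑ₙ p_n^{(k)} xⁿ`, where `p_n^{(k)}` is the number of
two-stack-sortable `k`-tuple `r`-permutations of `[n]` (components are allowed to be empty). -/
noncomputable def p (r k : ℕ) : PowerSeries ℚ :=
  PowerSeries.mk fun n => ({α | IsTwoStackSortableTuple r n k α}.ncard : ℚ)

end StackSort

namespace StackSort

open PowerSeries Finset

/-! ### Solving the functional equation: an explicit algebraic solution of the recursion. -/

section Algebra

variable {R : Type*} [CommRing R]

/-! Combinatorics. In a `(k+1)`-tuple the largest letter `M` lies in a single word. Cutting that
word at its `r` copies of `M` gives `r + 1` pieces. Put them after the `i` words on the left to form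
an `(i+r+1)`-tuple `A`, and let `B` be the `j` words on the right, `i + j = k`. One pass of `S` over
the words turns the tuple into (output of `A`) `M` (output of `B`), and the second pass gives `S(⋯)
S(⋯) M`. So the tuple is sortable iff `A` and `B` are, with all letters of `A` below those of `B`.
Nestedness matches as well, since a letter shared by two pieces would enclose `M`. As the
decomposition is bijective (`glue_bijective`), `p_{k+1} = 1 + x ∑_{i+j=k} p_{i+r+1} p_j` with `p_0 =
1` (`p_succ`, `p_zero`).

Algebra. The recursion has only one solution (`eq_of_recursion`), so it suffices to exhibit one.
With a second variable `X` marking `k` and `P = ∑ p_k X^k`, it reads `P = 1/(1-X) + x X T P`, where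
`T` is `P` with its first `r + 1` terms removed and divided by `X^(r+1)`. `exists_closed_form`
writes down such a `P` using the square roots of `1 - X` and `1 - (1+2y)² X`; its coefficient at `X`
is `1 + y - r y²`. -/

/-- The binomial series with exponent `1/2`, rescaled by `c`. -/
theorem exists_powerSeries_sq_eq [Algebra ℚ R] (c : R) :
    ∃ s : R⟦X⟧, s ^ 2 = 1 + C c * X ∧ constantCoeff s = 1 := by
  refine ⟨rescale c (binomialSeries R (1 / 2 : ℚ)), ?_, ?_⟩
  · rw [← map_pow, sq, ← binomialSeries_add]
    have h := binomialSeries_nat (R := ℚ) (A := R) 1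
    norm_num at h ⊢
    rw [h, map_add, map_one, rescale_X]
  · rw [← coeff_zero_eq_constantCoeff_apply, coeff_rescale]
    simp

theorem exists_mul_eq_one_of_constantCoeff {s : R⟦X⟧} (h : constantCoeff s = 1) :
    ∃ s' : R⟦X⟧, s * s' = 1 :=
  ⟨invOfUnit s 1, mul_invOfUnit s 1 (by simpa using h)⟩

/-- The solution in closed form of the recursion for the generating functions of the
two-stack-sortable tuples. -/
theorem exists_closed_form [Algebra ℚ R] (r : ℕ) (x y : R) (hy : IsUnit (1 + y))
    (hxy : x * (1 + y) ^ (2 * r + 1) = y) :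
    ∃ f : ℕ → R, f 0 = 1 ∧ f 1 = 1 + y - r * y ^ 2 ∧
      ∀ k, f (k + 1) = 1 + x * ∑ ij ∈ antidiagonal k, f (ij.1 + (r + 1)) * f ij.2 := by
  obtain ⟨h, hh⟩ : ∃ h : R, 2 * h = 1 :=
    ⟨algebraMap ℚ R (1 / 2), by
      rw [← map_ofNat (algebraMap ℚ R) 2, ← map_mul]; norm_num⟩
  -- Here `X` marks the tuple length, while `x` and `y` are constants of `R`. `u` and `v` are the
  -- two square roots, and `h` is `1/2`.
  obtain ⟨u, hu, hu0⟩ := exists_powerSeries_sq_eq (-1 : R)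
  obtain ⟨v, hv, hv0⟩ := exists_powerSeries_sq_eq (-(1 + 2 * y) ^ 2 : R)
  have coeff_one_sq : ∀ (s : R⟦X⟧) (c : R), s ^ 2 = 1 + C c * X → constantCoeff s = 1 →
      coeff 1 s = h * c := by
    intro s c hs hs0
    have := congrArg (coeff 1) hs
    rw [sq, coeff_one_mul, hs0] at this
    simp [coeff_one] at this
    linear_combination h * this - coeff 1 s * hh
  have hu1 := coeff_one_sq u _ hu hu0
  have hv1 := coeff_one_sq v _ hv hv0
  obtain ⟨u', hu'⟩ := exists_mul_eq_one_of_constantCoeff hu0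
  set Y : R⟦X⟧ := C y with hY
  have hH : 2 * (C h : R⟦X⟧) = 1 := by
    rw [← map_ofNat (C (R := R)) 2, ← map_mul, hh, map_one]
  have hC2 : (C (2 : R) : R⟦X⟧) = 2 := map_ofNat C 2
  have hu2 : u ^ 2 = 1 - X := by rw [hu]; simp [sub_eq_add_neg]
  have hv2 : v ^ 2 = 1 - (1 + 2 * Y) ^ 2 * X := by
    rw [hv, hY]; simp [sub_eq_add_neg, hC2]
  set G : R⟦X⟧ := C h * (u + v) with hG
  have hG0 : constantCoeff G = 1 := by
    simp only [hG, map_mul, map_add, hu0, hv0, constantCoeff_C]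
    linear_combination hh
  have hG1 : coeff 1 G = - h ^ 2 * (1 + (1 + 2 * y) ^ 2) := by
    rw [hG, coeff_C_mul, map_add, hu1, hv1]; ring
  obtain ⟨G', hG'⟩ := exists_mul_eq_one_of_constantCoeff hG0
  have hGG : G * (u - G) = Y * (1 + Y) * X := by
    have e : G * (u - G) = (C h) ^ 2 * (u ^ 2 - v ^ 2) + (1 - 2 * C h) * C h * u * (u + v) := by
      rw [hG]; ring
    rw [e, hH, hu2, hv2]
    linear_combination (Y * (1 + Y) * X * (2 * C h + 1)) * hH
  have hGb : Y * (1 + Y) * X * G' = u - G := by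
    linear_combination (u - G) * hG' - G' * hGG
  set D : R⟦X⟧ := Y * u + G with hD
  set E : R⟦X⟧ := u + (1 + Y) * X * G' with hE
  -- `M` and `N` are conjugate under `v ↦ -v`, which swaps `G` and `u - G`; their sum and product
  -- are therefore polynomials in `X`. `N` is divisible by `X`, `M` is not.
  set M : R⟦X⟧ := u * G + (1 + Y) * X with hM
  set N : R⟦X⟧ := u * (u - G) + (1 + Y) * X with hN
  have hMN : M + N = 1 + (1 + 2 * Y) * X := by
    linear_combination hu2
  have hMN' : M * N = (1 + Y) ^ 2 * X := by
    linear_combination u ^ 2 * hGG + (Y * (1 + Y) * X + (1 + Y) * X) * hu2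
  have hMEG : M = E * G := by
    linear_combination (-(1 + Y) * X) * hG'
  have hNDG : N = (1 + Y) * X * D * G' := by
    linear_combination (-(1 + Y) * X) * hG' - u * hGb
  have hED : E * D = 1 + Y := by
    linear_combination u * hGb + (1 + Y) * X * hG' + (1 + Y) * hu2
  have hYE : Y * E = Y * u + (u - G) := by
    linear_combination hGb
  -- A combination of powers of `M` and `N` satisfies their two-term linear recurrence. With the
  -- initial values `A 0` and `A 1` this makes `A j` a polynomial in `X` of degree at most `j`,
  -- which is `hdeg`.
  let A : ℕ → R⟦X⟧ := fun j => (Y * E * M ^ j + D * N ^ j) * u'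
  have hA0 : A 0 = 1 + 2 * Y := by
    simp only [A, pow_zero, mul_one, hYE]
    linear_combination (1 + 2 * Y) * hu'
  have hA1 : A 1 = Y + (1 + 2 * Y) ^ 2 * X := by
    simp only [A, pow_one, hYE]
    linear_combination (2 * u * u') * hGG + (Y * u ^ 2 + 2 * Y * (1 + Y) * X
      + (1 + 2 * Y) * (1 + Y) * X) * hu' + Y * hu2
  have hA2 : ∀ j, A (j + 2) = (1 + (1 + 2 * Y) * X) * A (j + 1) - (1 + Y) ^ 2 * X * A j := by
    intro j
    simp only [A, ← hMN, ← hMN']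
    ring
  have hdeg : ∀ j, (∀ n, j < n → coeff n (A j) = 0) ∧ ∀ n, j + 1 < n → coeff n (A (j + 1)) = 0 := by
    have hC1 : (1 + 2 * Y : R⟦X⟧) = C (1 + 2 * y) := by simp [hY, hC2]
    have hC3 : ((1 + Y) ^ 2 : R⟦X⟧) = C ((1 + y) ^ 2) := by simp [hY]
    have hC4 : ((1 + 2 * Y) ^ 2 : R⟦X⟧) = C ((1 + 2 * y) ^ 2) := by simp [hY, hC2]
    intro j
    induction j with
    | zero =>
      refine ⟨fun n hn => ?_, fun n hn => ?_⟩
      · rw [hA0, hC1, coeff_C, if_neg (by omega)]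
      · obtain ⟨n, rfl⟩ : ∃ m, n = m + 2 := ⟨n - 2, by omega⟩
        rw [zero_add, hA1, hC4, map_add, hY, coeff_C, coeff_succ_mul_X, coeff_C]
        simp
    | succ j ih =>
      refine ⟨ih.2, fun n hn => ?_⟩
      obtain ⟨n, rfl⟩ : ∃ m, n = m + 1 := ⟨n - 1, by omega⟩
      have e : A (j + 1 + 1) = A (j + 1) + C (1 + 2 * y) * (A (j + 1) * X)
          - C ((1 + y) ^ 2) * (A j * X) := by
        rw [show j + 1 + 1 = j + 2 from rfl, hA2, ← hC1, ← hC3]; ring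
      rw [e, map_sub, map_add, coeff_C_mul, coeff_C_mul, coeff_succ_mul_X, coeff_succ_mul_X,
        ih.2 _ (by omega), ih.2 _ (by omega), ih.1 _ (by omega)]
      simp
  set P : R⟦X⟧ := E * M ^ r * u' with hP
  set W : R⟦X⟧ := (1 + Y) ^ r * D ^ (r + 1) * G' ^ r * u' with hW
  set c : R := (1 + y) ^ (2 * r + 1) with hc
  have hcY : (1 + Y) ^ (2 * r + 1) = (C c : R⟦X⟧) := by simp [hY, hc]
  have hAPW : A r = Y * P + X ^ r * W := by
    simp only [A, hP, hW, hNDG, mul_pow]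
    ring
  have hG'0 : constantCoeff G' = 1 := by
    have := congrArg constantCoeff hG'
    simpa [hG0] using this
  have hu'0 : constantCoeff u' = 1 := by
    have := congrArg constantCoeff hu'
    simpa [hu0] using this
  have hD0 : constantCoeff D = 1 + y := by
    simp [hD, hY, hu0, hG0, add_comm]
  have hE0 : constantCoeff E = 1 := by simp [hE, hu0]
  have hM0 : constantCoeff M = 1 := by simp [hM, hu0, hG0]
  have hP0 : constantCoeff P = 1 := by simp [hP, hE0, hM0, hu'0]
  have hW0 : constantCoeff W = c := by
    simp only [hW, map_mul, map_pow, map_add, map_one, hD0, hG'0, hu'0, hY, constantCoeff_C, hc]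
    ring
  let T : R⟦X⟧ := mk fun n => coeff (n + (r + 1)) P
  -- `Y P + X^r W = A r` has no terms beyond `X^r`, so the higher coefficients of `W` are those of
  -- `-Y P`, shifted by `r`; the constant term of `W` is `c`.
  have hWT : W = C c - X * (Y * T) := by
    ext n
    cases n with
    | zero => simp [hW0]
    | succ n =>
      have h1 := (hdeg r).1 (n + 1 + r) (by omega)
      rw [hAPW, map_add, hY, coeff_C_mul, coeff_X_pow_mul] at h1
      rw [map_sub, coeff_C, if_neg (by omega), coeff_succ_X_mul, hY, coeff_C_mul, coeff_mk,
        show n + (r + 1) = n + 1 + r by omega]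
      linear_combination h1
  have hPW : P * W = C c * u' ^ 2 := by
    have e : P * W = (1 + Y) ^ r * (E * D) ^ (r + 1) * (G * G') ^ r * u' ^ 2 := by
      simp only [hP, hW, hMEG, mul_pow]; ring
    rw [e, hED, hG', ← hcY]; ring
  have hgeo : u' ^ 2 = mk (fun _ => (1 : R)) := by
    have h1 : u' ^ 2 * (1 - X) = 1 := by
      rw [← hu2]; linear_combination (u * u' + 1) * hu'
    have h2 := mk_one_mul_one_sub_eq_one R
    calc u' ^ 2 = u' ^ 2 * (PowerSeries.mk 1 * (1 - X)) := by rw [h2, mul_one]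
      _ = PowerSeries.mk 1 * (u' ^ 2 * (1 - X)) := by ring
      _ = _ := by rw [h1, mul_one]; rfl
  have hcu : IsUnit (C c : R⟦X⟧) := (hy.pow _).map C
  have hYx : Y = C x * C c := by rw [← map_mul, hc, hxy]
  -- Insert `W = c - X Y T` and `Y = x c` into `P W = c/(1-X)` and cancel the unit `c`.
  have key : P = mk (fun _ => (1 : R)) + C x * (X * (T * P)) := by
    apply hcu.mul_left_cancel
    rw [← hgeo, mul_add, ← hPW, hWT, hYx]
    ring
  refine ⟨fun k => coeff k P, ?_, ?_, fun k => ?_⟩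
  · simpa using hP0
  · have hPu : P * u = E * M ^ r := by
      rw [hP]; linear_combination (E * M ^ r) * hu'
    clear_value P
    have h1 := congrArg (coeff 1) hPu
    have hE1 : coeff 1 E = coeff 1 u + (1 + y) := by
      rw [hE, map_add, show (1 + Y) * X * G' = C (1 + y) * (X * G') by simp [hY, mul_assoc],
        coeff_C_mul, show (1 : ℕ) = 0 + 1 from rfl, coeff_succ_X_mul]
      simp [hG'0]
    have hM1 : coeff 1 M = coeff 1 u + coeff 1 G + (1 + y) := by
      rw [hM, map_add, coeff_one_mul, hu0, hG0,
        show (1 + Y) * X = C (1 + y) * X by simp [hY], coeff_C_mul]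
      simp
    rw [coeff_one_mul, coeff_one_mul, coeff_one_pow, hP0, hu0, hE1, map_pow, hE0, hM0, hM1, hu1,
      hG1] at h1
    simp only [one_pow, mul_one] at h1
    linear_combination h1 - r * ((1 + h) + (y + y ^ 2) * (1 + 2 * h)) * hh
  · clear_value P
    have := congrArg (coeff (k + 1)) key
    rw [map_add, coeff_mk, coeff_C_mul, coeff_succ_X_mul, coeff_mul] at this
    simpa [T] using this

end Algebra

end StackSort

namespace StackSort

/-! ### Words: letters of `S w`, cutting at the largest letter, nestedness through sublists. -/

section Words

theorem mem_S_iff (w : List ℕ) : ∀ x, x ∈ S w ↔ x ∈ w := by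
  induction hn : w.length using Nat.strong_induction_on generalizing w with
  | _ n ih =>
    intro x
    by_cases h : w = []
    · simp [h, S_nil]
    · rw [S_of_ne_nil w h]
      have hm := List.max_mem h
      generalize w.max h = m at hm ⊢
      have hS : ∀ u ∈ w.splitOn m, (x ∈ S u ↔ x ∈ u) := fun u hu =>
        ih _ (hn ▸ (length_lt_of_mem_splitOn m w u hu).2 hm) u rfl x
      have key : ∀ L : List (List ℕ), L ≠ [] →
          (x ∈ [m].intercalate L ↔ x ∈ L.flatten ∨ (x = m ∧ 2 ≤ L.length)) := by
        intro L hL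
        induction L with
        | nil => exact absurd rfl hL
        | cons a L ih =>
          cases L with
          | nil => simp
          | cons b L =>
            rw [List.intercalate_cons_cons]
            simp only [List.mem_append, ih (by simp), List.flatten_cons, List.mem_singleton,
              List.length_cons]
            constructor
            · rintro ((h | h) | h | h) <;> simp_all
            · rintro ((h | h | h) | h) <;> simp_all
      -- The maximum occurs in `w`, so the cut is proper and the separator reappears on joining.
      have hlen : 2 ≤ (w.splitOn m).length := by
        by_contra hc
        have hne := List.splitOn_ne_nil m w
        have h1 : (w.splitOn m).length = 1 := by
          have := List.length_pos_iff.2 hne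
          omega
        obtain ⟨a, ha⟩ := List.length_eq_one_iff.1 h1
        have h2 := (length_lt_of_mem_splitOn m w a (by simp [ha])).2 hm
        have h3 := List.intercalate_splitOn (xs := w) m
        rw [ha, List.intercalate_singleton] at h3
        exact absurd h2 (by simp [h3])
      have h3 := key _ (List.splitOn_ne_nil m w)
      rw [List.intercalate_splitOn] at h3
      rw [h3]
      simp only [List.mem_append, List.mem_flatten, List.mem_map, List.mem_singleton, hlen,
        and_true]
      constructor
      · rintro (⟨_, ⟨u, hu, rfl⟩, hx⟩ | hx)
        · exact Or.inl ⟨u, hu, (hS u hu).1 hx⟩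
        · exact Or.inr hx
      · rintro (⟨u, hu, hx⟩ | hx)
        · exact Or.inl ⟨_, ⟨u, hu, rfl⟩, (hS u hu).2 hx⟩
        · exact Or.inr hx

theorem mem_map_S_flatten_iff (L : List (List ℕ)) (x : ℕ) :
    x ∈ (L.map S).flatten ↔ x ∈ L.flatten := by
  simp [List.mem_flatten, mem_S_iff]

theorem mem_intercalate_iff {m x : ℕ} {L : List (List ℕ)} (hL : 2 ≤ L.length) :
    x ∈ [m].intercalate L ↔ x ∈ L.flatten ∨ x = m := by
  induction L with
  | nil => simp at hL
  | cons a L ih =>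
    match L with
    | [] => simp at hL
    | [b] => simp [List.intercalate_cons_cons, or_assoc, or_comm (a := x = m)]
    | b :: c :: L =>
      rw [List.intercalate_cons_cons, List.mem_append, ih (by simp), List.flatten_cons (L := b :: c :: L)]
      simp only [List.mem_append, List.mem_singleton]
      tauto

theorem count_intercalate_self {m : ℕ} {L : List (List ℕ)} (hL : L ≠ []) (hm : m ∉ L.flatten) :
    ([m].intercalate L).count m + 1 = L.length := by
  induction L with
  | nil => exact absurd rfl hL
  | cons a L ih =>
    have ha : a.count m = 0 := List.count_eq_zero.2 fun h => hm (by simp [h])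
    cases L with
    | nil => simp [ha]
    | cons b L =>
      have := ih (by simp) fun h => hm (by rw [List.flatten_cons]; exact List.mem_append_right _ h)
      rw [List.intercalate_cons_cons]
      simp only [List.count_append, ha, List.count_singleton_self, List.length_cons] at this ⊢
      omega

theorem count_intercalate_of_ne {m x : ℕ} (hx : x ≠ m) (L : List (List ℕ)) :
    ([m].intercalate L).count x = L.flatten.count x := by
  induction L with
  | nil => simp
  | cons a L ih =>
    cases L with
    | nil => simp
    | cons b L =>
      rw [List.intercalate_cons_cons, List.flatten_cons, List.count_append, List.count_append, ih,
        List.count_append, List.count_eq_zero.2 (by simpa using hx : x ∉ [m])]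
      omega

theorem S_intercalate {m : ℕ} {L : List (List ℕ)} (hL : 2 ≤ L.length)
    (hm : ∀ x ∈ L.flatten, x < m) :
    S ([m].intercalate L) = (L.map S).flatten ++ [m] := by
  have hmem : m ∈ [m].intercalate L := (mem_intercalate_iff hL).2 (Or.inr rfl)
  have hne : [m].intercalate L ≠ [] := List.ne_nil_of_mem hmem
  have hmax : ([m].intercalate L).max hne = m := by
    rw [List.max_eq_iff]
    refine ⟨hmem, fun b hb => ?_⟩
    rcases (mem_intercalate_iff hL).1 hb with h | h
    · exact (hm b h).le
    · exact h.le
  rw [S_of_ne_nil _ hne, hmax, List.splitOn_intercalate]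
  · intro l hl h
    exact lt_irrefl m (hm m (List.mem_flatten.2 ⟨l, hl, h⟩))
  · rintro rfl
    simp at hL

theorem S_append_singleton_append {m : ℕ} {u v : List ℕ} (hu : ∀ x ∈ u, x < m)
    (hv : ∀ x ∈ v, x < m) : S (u ++ [m] ++ v) = S u ++ S v ++ [m] := by
  have := S_intercalate (m := m) (L := [u, v]) (by simp) (by
    intro x hx
    simp only [List.flatten_cons, List.flatten_nil, List.append_nil, List.mem_append] at hx
    exact hx.elim (hu x) (hv x))
  simpa [List.intercalate_cons_cons] using this

/-- The letters between two equal letters `x` of the word are at most `x`. -/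
def Nested (w : List ℕ) : Prop := ∀ x y : ℕ, [x, y, x].Sublist w → y ≤ x

theorem Nested.of_sublist {u w : List ℕ} (hw : Nested w) (h : u.Sublist w) : Nested u :=
  fun x y hxy => hw x y (hxy.trans h)

/-- Trades positions for the pattern `x y x`, which is easier to follow through concatenations. -/
theorem nested_iff_get (w : List ℕ) :
    Nested w ↔ ∀ i j k : Fin w.length, i < j → j < k → w.get i = w.get k → w.get j ≤ w.get i := by
  constructor
  · intro h i j k hij hjk hik
    refine h _ _ ?_
    have hs := List.map_getElem_sublist (l := w) (is := [i, j, k]) (by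
      simp [hij, hjk, hij.trans hjk])
    simp only [List.get_eq_getElem, List.map_cons, List.map_nil, ← Fin.getElem_fin] at hs hik ⊢
    rwa [← hik] at hs
  · intro h x y hs
    obtain ⟨f, hf⟩ := List.sublist_iff_exists_fin_orderEmbedding_get_eq.1 hs
    have h0 := hf ⟨0, by simp⟩
    have h1 := hf ⟨1, by simp⟩
    have h2 := hf ⟨2, by simp⟩
    simp only [List.get_eq_getElem, List.getElem_cons_zero, List.getElem_cons_succ] at h0 h1 h2
    have := h (f ⟨0, by simp⟩) (f ⟨1, by simp⟩) (f ⟨2, by simp⟩)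
      (f.lt_iff_lt.2 (by simp)) (f.lt_iff_lt.2 (by simp [Fin.lt_def]))
    simp only [List.get_eq_getElem, ← h0, ← h1, ← h2] at this
    exact this trivial

/-- If the cut falls inside the pattern, its two outer letters land on opposite sides. -/
theorem sublist_append_cases {x y : ℕ} {u v : List ℕ} (h : [x, y, x].Sublist (u ++ v)) :
    [x, y, x].Sublist u ∨ [x, y, x].Sublist v ∨ (x ∈ u ∧ x ∈ v) := by
  obtain ⟨l₁, l₂, h1, hu, hv⟩ := List.sublist_append_iff.1 h
  match l₁, h1 with
  | [], h1 =>
    rw [List.nil_append] at h1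
    exact Or.inr (Or.inl (h1 ▸ hv))
  | [a], h1 =>
    simp only [List.cons_append, List.nil_append, List.cons.injEq] at h1
    obtain ⟨rfl, rfl⟩ := h1
    exact Or.inr (Or.inr ⟨hu.subset (by simp), hv.subset (by simp)⟩)
  | [a, b], h1 =>
    simp only [List.cons_append, List.nil_append, List.cons.injEq] at h1
    obtain ⟨rfl, rfl, rfl⟩ := h1
    exact Or.inr (Or.inr ⟨hu.subset (by simp), hv.subset (by simp)⟩)
  | a :: b :: c :: l, h1 =>
    simp only [List.cons_append, List.cons.injEq] at h1
    obtain ⟨rfl, rfl, rfl, h1⟩ := h1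
    obtain ⟨rfl, rfl⟩ := List.append_eq_nil_iff.1 h1.symm
    exact Or.inl hu

theorem nested_append_iff_of_disjoint {u v : List ℕ} (huv : u.Disjoint v) :
    Nested (u ++ v) ↔ Nested u ∧ Nested v := by
  refine ⟨fun h => ⟨h.of_sublist (List.sublist_append_left u v),
    h.of_sublist (List.sublist_append_right u v)⟩, fun ⟨hu, hv⟩ x y h => ?_⟩
  rcases sublist_append_cases h with h | h | h
  · exact hu x y h
  · exact hv x y h
  · exact absurd h.2 (huv h.1)

theorem disjoint_flatten_right {a : List ℕ} {L : List (List ℕ)} :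
    a.Disjoint L.flatten ↔ ∀ w ∈ L, a.Disjoint w := by
  simp only [List.Disjoint, List.mem_flatten]
  grind

theorem nested_flatten_iff {L : List (List ℕ)} (hL : L.Pairwise List.Disjoint) :
    Nested L.flatten ↔ ∀ w ∈ L, Nested w := by
  induction L with
  | nil => simp [Nested]
  | cons a L ih =>
    rw [List.pairwise_cons] at hL
    rw [List.flatten_cons, nested_append_iff_of_disjoint, ih hL.2]
    · simp
    · rw [disjoint_flatten_right]
      exact hL.1

/-- A letter `x < m` on both sides would give the forbidden pattern `x m x`. The bound on `v` is
weak so that `v` may contain further copies of `m`, as the induction over the pieces requires. -/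
theorem nested_append_singleton_append_iff {m : ℕ} {u v : List ℕ} (hu : ∀ x ∈ u, x < m)
    (hv : ∀ x ∈ v, x ≤ m) : Nested (u ++ [m] ++ v) ↔ Nested u ∧ Nested v ∧ u.Disjoint v := by
  constructor
  · refine fun h => ⟨h.of_sublist ?_, h.of_sublist (List.sublist_append_right _ v),
      fun x hxu hxv => ?_⟩
    · rw [List.append_assoc]
      exact List.sublist_append_left u _
    · have h1 : ([x] ++ [m] ++ [x]).Sublist (u ++ [m] ++ v) :=
        ((List.singleton_sublist.2 hxu).append (List.Sublist.refl [m])).append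
          (List.singleton_sublist.2 hxv)
      exact absurd (h x m h1) (not_le.2 (hu x hxu))
  · rintro ⟨h1, h2, h3⟩ x y h
    have hy : y ≤ m := by
      have : y ∈ u ++ [m] ++ v := h.subset (by simp)
      simp only [List.mem_append, List.mem_singleton] at this
      rcases this with (h | h) | h
      · exact (hu y h).le
      · exact h.le
      · exact hv y h
    by_cases hx : x = m
    · exact hx ▸ hy
    · rw [List.append_assoc] at h
      rcases sublist_append_cases h with h | h | h
      · exact h1 x y h
      · rcases sublist_append_cases h with h | h | h
        · have := h.length_le
          simp at this
        · exact h2 x y h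
        · exact absurd (List.mem_singleton.1 h.1) hx
      · have hxv : x ∈ v := by simpa [hx] using h.2
        exact absurd hxv (h3 h.1)

theorem nested_intercalate_iff {m : ℕ} {L : List (List ℕ)} (hm : ∀ x ∈ L.flatten, x < m) :
    Nested ([m].intercalate L) ↔ (∀ w ∈ L, Nested w) ∧ L.Pairwise List.Disjoint := by
  induction L with
  | nil => simp [Nested]
  | cons a L ih =>
    cases L with
    | nil => simp
    | cons b L =>
      have hm' : ∀ x ∈ (b :: L).flatten, x < m := fun x hx =>
        hm x (by rw [List.flatten_cons]; exact List.mem_append_right _ hx)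
      have hma : ∀ x ∈ a, x < m := fun x hx =>
        hm x (by rw [List.flatten_cons]; exact List.mem_append_left _ hx)
      have hmem : ∀ x, x ∈ [m].intercalate (b :: L) → x ∈ (b :: L).flatten ∨ x = m := by
        intro x hx
        cases L with
        | nil => left; simpa using hx
        | cons c L => exact (mem_intercalate_iff (by simp)).1 hx
      have hmem' : ∀ x, x ≠ m → (x ∈ [m].intercalate (b :: L) ↔ x ∈ (b :: L).flatten) := by
        intro x hx
        rw [← List.count_pos_iff, count_intercalate_of_ne hx, List.count_pos_iff]
      have hdis : a.Disjoint ([m].intercalate (b :: L)) ↔ ∀ w ∈ b :: L, a.Disjoint w := by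
        rw [← disjoint_flatten_right]
        exact forall_congr' fun x => forall_congr' fun hx =>
          not_congr (hmem' x (hma x hx).ne)
      rw [List.intercalate_cons_cons, nested_append_singleton_append_iff hma, ih hm', hdis,
        List.forall_mem_cons (l := b :: L), List.pairwise_cons (l := b :: L)]
      · tauto
      · intro x hx
        rcases hmem x hx with h | h
        · exact (hm' x h).le
        · exact h.le

end Words

end StackSort

namespace StackSort

open Finset

/-! ### Tuples: decomposition at the largest letter, and counting. -/

section Tuples

theorem pairwise_disjoint_append_iff {L L' : List (List ℕ)} :
    (L ++ L').Pairwise List.Disjoint ↔ L.Pairwise List.Disjoint ∧ L'.Pairwise List.Disjoint ∧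
      L.flatten.Disjoint L'.flatten := by
  rw [List.pairwise_append]
  simp only [List.Disjoint, List.mem_flatten]
  grind

theorem notMem_of_mem_splitOn (m : ℕ) (w : List ℕ) : ∀ u ∈ w.splitOn m, m ∉ u := by
  induction w with
  | nil => simp
  | cons a w ih =>
    rw [List.splitOn_cons_eq_if_modifyHead]
    obtain ⟨v, vs, hv⟩ := List.exists_cons_of_ne_nil (List.splitOn_ne_nil m w)
    rw [hv] at ih ⊢
    by_cases ha : a = m
    · simpa [ha] using ih
    · simpa [ha, Ne.symm (Ne.intro ha)] using ih

theorem eq_range'_of_append_eq_range' {a n : ℕ} {u v : List ℕ} (h : u ++ v = List.range' a n) :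
    ∃ m m', m + m' = n ∧ u = List.range' a m ∧ v = List.range' (a + m) m' := by
  have hl : u.length + v.length = n := by
    rw [← List.length_append, h, List.length_range']
  refine ⟨u.length, v.length, hl, ?_⟩
  rw [← hl, ← List.range'_append_1] at h
  exact List.append_inj h (by simp)

/-- Each word is nested, different words have no common letter, and every letter that occurs
occurs `r` times. -/
def IsNestedTuple (r : ℕ) (L : List (List ℕ)) : Prop :=
  (∀ w ∈ L, Nested w) ∧ L.Pairwise List.Disjoint ∧ ∀ x ∈ L.flatten, L.flatten.count x = r

theorem isNestedTuple_glue_iff {r m : ℕ} (hr : 1 ≤ r) {A B C : List (List ℕ)}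
    (hB : B.length = r + 1) (hAm : ∀ x ∈ A.flatten, x < m) (hBm : ∀ x ∈ B.flatten, x < m)
    (hCm : ∀ x ∈ C.flatten, x < m) :
    IsNestedTuple r (A ++ [m].intercalate B :: C) ↔
      IsNestedTuple r (A ++ B) ∧ IsNestedTuple r C ∧ (A ++ B).flatten.Disjoint C.flatten := by
  have hmem : ∀ x, x ∈ [m].intercalate B ↔ x ∈ B.flatten ∨ x = m := fun x =>
    mem_intercalate_iff (by omega)
  have hcount : ∀ x, x ≠ m → (A ++ [m].intercalate B :: C).flatten.count x =
      (A ++ B).flatten.count x + C.flatten.count x := by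
    intro x hx
    simp only [List.flatten_append, List.flatten_cons, List.count_append,
      count_intercalate_of_ne hx]
    omega
  have hcountm : (A ++ [m].intercalate B :: C).flatten.count m = r := by
    have h1 : A.flatten.count m = 0 := List.count_eq_zero.2 fun h => lt_irrefl m (hAm m h)
    have h2 : C.flatten.count m = 0 := List.count_eq_zero.2 fun h => lt_irrefl m (hCm m h)
    have h3 := count_intercalate_self (m := m) (L := B) (by rintro rfl; simp at hB)
      fun h => lt_irrefl m (hBm m h)
    rw [List.flatten_append, List.flatten_cons, List.count_append, List.count_append, h1, h2]
    omega
  have hmemL : ∀ x, x ∈ (A ++ [m].intercalate B :: C).flatten ↔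
      x ∈ (A ++ B).flatten ∨ x = m ∨ x ∈ C.flatten := by
    intro x
    rw [List.flatten_append, List.flatten_append, List.flatten_cons, List.mem_append,
      List.mem_append, List.mem_append, hmem]
    tauto
  -- Disjointness of the glued tuple does not see the pieces `B` separately; their mutual
  -- disjointness is supplied by nestedness of the joined word, in `hN`.
  have hPD : (A ++ [m].intercalate B :: C).Pairwise List.Disjoint ∧ B.Pairwise List.Disjoint ↔
      (A ++ B).Pairwise List.Disjoint ∧ C.Pairwise List.Disjoint ∧
        (A ++ B).flatten.Disjoint C.flatten := by
    rw [pairwise_disjoint_append_iff, pairwise_disjoint_append_iff, List.pairwise_cons,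
      ← disjoint_flatten_right]
    simp only [List.Disjoint, List.flatten_append, List.flatten_cons, List.mem_append, hmem]
    constructor
    · rintro ⟨⟨h1, ⟨h2, h3⟩, h4⟩, h5⟩
      refine ⟨⟨h1, h5, fun x hx hx' => h4 hx (Or.inl (Or.inl hx'))⟩, h3, fun x hx hx' => ?_⟩
      rcases hx with hx | hx
      · exact h4 hx (Or.inr hx')
      · exact h2 (Or.inl hx) hx'
    · rintro ⟨⟨h1, h5, h4⟩, h3, h2⟩
      refine ⟨⟨h1, ⟨fun x hx hx' => ?_, h3⟩, fun x hx hx' => ?_⟩, h5⟩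
      · rcases hx with hx | rfl
        · exact h2 (Or.inr hx) hx'
        · exact lt_irrefl _ (hCm _ hx')
      · rcases hx' with (hx' | rfl) | hx'
        · exact h4 hx hx'
        · exact lt_irrefl _ (hAm _ hx)
        · exact h2 (Or.inl hx) hx'
  have hN : (∀ w ∈ A ++ [m].intercalate B :: C, Nested w) ↔
      (∀ w ∈ A ++ B, Nested w) ∧ (∀ w ∈ C, Nested w) ∧ B.Pairwise List.Disjoint := by
    simp only [List.forall_mem_append, List.forall_mem_cons, nested_intercalate_iff hBm]
    tauto
  constructor
  · rintro ⟨h1, h2, h3⟩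
    obtain ⟨h4, h5, h6⟩ := hN.1 h1
    obtain ⟨h7, h8, h9⟩ := hPD.1 ⟨h2, h6⟩
    refine ⟨⟨h4, h7, fun x hx => ?_⟩, ⟨h5, h8, fun x hx => ?_⟩, h9⟩
    · have hxm : x ≠ m := by
        rintro rfl
        rw [List.flatten_append, List.mem_append] at hx
        exact hx.elim (fun h => lt_irrefl _ (hAm _ h)) (fun h => lt_irrefl _ (hBm _ h))
      have := h3 x ((hmemL x).2 (Or.inl hx))
      rw [hcount x hxm, List.count_eq_zero.2 (h9 hx)] at this
      exact this
    · have hxm : x ≠ m := (hCm x hx).ne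
      have := h3 x ((hmemL x).2 (Or.inr (Or.inr hx)))
      rw [hcount x hxm, List.count_eq_zero.2 (fun h => h9 h hx), zero_add] at this
      exact this
  · rintro ⟨⟨h4, h7, h10⟩, ⟨h5, h8, h11⟩, h9⟩
    obtain ⟨h2, h6⟩ := hPD.2 ⟨h7, h8, h9⟩
    refine ⟨hN.2 ⟨h4, h5, h6⟩, h2, fun x hx => ?_⟩
    by_cases hxm : x = m
    · rw [hxm, hcountm]
    · rw [hcount x hxm]
      rcases (hmemL x).1 hx with hx | hx | hx
      · rw [h10 x hx, List.count_eq_zero.2 (h9 hx), add_zero]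
      · exact absurd hx hxm
      · rw [h11 x hx, List.count_eq_zero.2 (fun h => h9 h hx), zero_add]

/-- The first pass leaves a single `m`, placed after the outputs of `A` and `B`; the second pass
cuts there. -/
theorem S_map_S_glue {m : ℕ} {A B C : List (List ℕ)} (hB : 2 ≤ B.length)
    (hAm : ∀ x ∈ A.flatten, x < m) (hBm : ∀ x ∈ B.flatten, x < m) (hCm : ∀ x ∈ C.flatten, x < m) :
    S ((A ++ [m].intercalate B :: C).map S).flatten =
      S ((A ++ B).map S).flatten ++ S (C.map S).flatten ++ [m] := by
  have h : ((A ++ [m].intercalate B :: C).map S).flatten =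
      ((A ++ B).map S).flatten ++ [m] ++ (C.map S).flatten := by
    simp [S_intercalate hB hBm]
  rw [h, S_append_singleton_append]
  · intro x hx
    rw [mem_map_S_flatten_iff, List.flatten_append, List.mem_append] at hx
    exact hx.elim (hAm x) (hBm x)
  · intro x hx
    rw [mem_map_S_flatten_iff] at hx
    exact hCm x hx

/-- The two-stack-sortable `k`-tuples of words with letters `a, a + 1, …, a + n - 1`, each of them
occurring `r` times. -/
def sortableTuples (r a n k : ℕ) : Set (List (List ℕ)) :=
  {L | L.length = k ∧ IsNestedTuple r L ∧ S (L.map S).flatten = List.range' a n}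

theorem mem_flatten_iff_of_S_eq {a n : ℕ} {L : List (List ℕ)}
    (h : S (L.map S).flatten = List.range' a n) (x : ℕ) :
    x ∈ L.flatten ↔ a ≤ x ∧ x < a + n := by
  rw [← mem_map_S_flatten_iff, ← mem_S_iff, h, List.mem_range'_1]

theorem glue_mem_sortableTuples {r a i j m n : ℕ} (hr : 1 ≤ r) {A B : List (List ℕ)}
    (hA : A ∈ sortableTuples r a m (i + (r + 1))) (hB : B ∈ sortableTuples r (a + m) n j) :
    A.take i ++ [a + (m + n)].intercalate (A.drop i) :: B ∈
      sortableTuples r a (m + n + 1) (i + j + 1) := by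
  obtain ⟨hAl, hAt, hAs⟩ := hA
  obtain ⟨hBl, hBt, hBs⟩ := hB
  have hAm : ∀ x ∈ A.flatten, x < a + (m + n) := fun x hx => by
    have := (mem_flatten_iff_of_S_eq hAs x).1 hx
    omega
  have hBm : ∀ x ∈ B.flatten, x < a + (m + n) := fun x hx => by
    have := (mem_flatten_iff_of_S_eq hBs x).1 hx
    omega
  have hA' : ∀ x ∈ (A.take i ++ A.drop i).flatten, x < a + (m + n) := by
    rwa [List.take_append_drop]
  simp only [List.flatten_append, List.forall_mem_append] at hA'
  have hl : (A.drop i).length = r + 1 := by simp [hAl]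
  refine ⟨?_, (isNestedTuple_glue_iff hr hl hA'.1 hA'.2 hBm).2 ?_, ?_⟩
  · simp [hAl, hBl]
    omega
  · rw [List.take_append_drop]
    refine ⟨hAt, hBt, fun x hx hx' => ?_⟩
    have h1 := (mem_flatten_iff_of_S_eq hAs x).1 hx
    have h2 := (mem_flatten_iff_of_S_eq hBs x).1 hx'
    omega
  · rw [S_map_S_glue (by omega) hA'.1 hA'.2 hBm, List.take_append_drop, hAs, hBs,
      List.range'_append_1, ← List.range'_1_concat]

/-- Once the final `a + n` is removed, the sorted output is a concatenation of two blocks equal to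
an interval. Each block is thus itself an interval, and the letters of `A ++ B` precede those of
`C`. -/
theorem exists_glue_of_mem_sortableTuples {r a n k : ℕ} (hr : 1 ≤ r) {L : List (List ℕ)}
    (hL : L ∈ sortableTuples r a (n + 1) k) :
    ∃ i j m m' A B, i + j + 1 = k ∧ m + m' = n ∧ A ∈ sortableTuples r a m (i + (r + 1)) ∧
      B ∈ sortableTuples r (a + m) m' j ∧
      A.take i ++ [a + n].intercalate (A.drop i) :: B = L := by
  obtain ⟨hLl, hLt, hLs⟩ := hL
  have hlt := mem_flatten_iff_of_S_eq hLs
  obtain ⟨w, hw, hmw⟩ := List.mem_flatten.1 ((hlt (a + n)).2 (by omega))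
  obtain ⟨A, C, rfl⟩ := List.append_of_mem hw
  have hdis := hLt.2.1
  rw [pairwise_disjoint_append_iff, List.pairwise_cons, ← disjoint_flatten_right] at hdis
  obtain ⟨-, ⟨hwC, -⟩, hA⟩ := hdis
  have hmC : a + n ∉ C.flatten := hwC hmw
  have hmA : a + n ∉ A.flatten := fun h => hA h (by simp [hmw])
  obtain ⟨B, hBw⟩ : ∃ B, w.splitOn (a + n) = B := ⟨_, rfl⟩
  have hBJ : [a + n].intercalate B = w := by rw [← hBw, List.intercalate_splitOn]
  have hBmem : ∀ x ∈ B.flatten, x < a + n := by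
    have hne : B ≠ [] := hBw ▸ List.splitOn_ne_nil _ _
    have hnotMem : a + n ∉ B.flatten := by
      intro h
      obtain ⟨u, hu, hmu⟩ := List.mem_flatten.1 h
      exact notMem_of_mem_splitOn _ w u (hBw ▸ hu) hmu
    intro x hx
    have hxm : x ≠ a + n := by
      rintro rfl
      exact hnotMem hx
    have hxw : x ∈ w := by
      rw [← hBJ, ← List.count_pos_iff, count_intercalate_of_ne hxm, List.count_pos_iff]
      exact hx
    have := (hlt x).1 (List.mem_flatten.2 ⟨w, hw, hxw⟩)
    omega
  have hAmem : ∀ x ∈ A.flatten, x < a + n := by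
    intro x hx
    have h1 := (hlt x).1 (by rw [List.flatten_append]; exact List.mem_append_left _ hx)
    have : x ≠ a + n := by rintro rfl; exact hmA hx
    omega
  have hCmem : ∀ x ∈ C.flatten, x < a + n := by
    intro x hx
    have h1 := (hlt x).1 (by
      rw [List.flatten_append, List.flatten_cons]
      exact List.mem_append_right _ (List.mem_append_right _ hx))
    have : x ≠ a + n := by rintro rfl; exact hmC hx
    omega
  have hBl : B.length = r + 1 := by
    rw [← count_intercalate_self (m := a + n) (L := B) (hBw ▸ List.splitOn_ne_nil _ _)
      (fun h => lt_irrefl _ (hBmem _ h)), hBJ,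
      ← hLt.2.2 (a + n) (List.mem_flatten.2 ⟨w, hw, hmw⟩), List.flatten_append, List.flatten_cons,
      List.count_append, List.count_append, List.count_eq_zero.2 hmA, List.count_eq_zero.2 hmC]
    omega
  rw [← hBJ] at hLt hLs
  rw [isNestedTuple_glue_iff hr hBl hAmem hBmem hCmem] at hLt
  rw [S_map_S_glue (by omega) hAmem hBmem hCmem, List.range'_1_concat] at hLs
  have hs := List.append_inj_left' hLs rfl
  obtain ⟨h1, h2, h3⟩ := hLt
  obtain ⟨m, m', hm, hs1, hs2⟩ := eq_range'_of_append_eq_range' hs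
  refine ⟨A.length, C.length, m, m', A ++ B, C, ?_, hm, ⟨by simp [hBl], h1, hs1⟩,
    ⟨rfl, h2, hs2⟩, by simp [hBJ]⟩
  rw [← hLl, List.length_append, List.length_cons]
  omega

theorem append_cons_inj_of_forall {α : Type*} {p : α → Prop} {A A' B B' : List α} {b b' : α}
    (hA : ∀ a ∈ A, ¬ p a) (hA' : ∀ a ∈ A', ¬ p a) (hb : p b) (hb' : p b')
    (h : A ++ b :: B = A' ++ b' :: B') : A = A' ∧ b = b' ∧ B = B' := by
  induction A generalizing A' with
  | nil =>
    cases A' with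
    | nil => simpa using h
    | cons c A' =>
      simp only [List.nil_append, List.cons_append, List.cons.injEq] at h
      exact absurd (h.1 ▸ hb) (hA' c (by simp))
  | cons c A ih =>
    cases A' with
    | nil =>
      simp only [List.nil_append, List.cons_append, List.cons.injEq] at h
      exact absurd (h.1 ▸ hb') (hA c (by simp))
    | cons c' A' =>
      simp only [List.cons_append, List.cons.injEq] at h
      obtain ⟨h1, h2, h3⟩ := ih (fun a ha => hA a (by simp [ha])) (fun a ha => hA' a (by simp [ha]))
        h.2
      exact ⟨by rw [h.1, h1], h2, h3⟩

/-- The word containing `M` marks the gluing place, and splitting it at `M` recovers the pieces; all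
sizes are then lengths. -/
theorem glue_inj {r a i i' j j' m m' n n' : ℕ} (hr : 1 ≤ r) {A A' B B' : List (List ℕ)} {M : ℕ}
    (hA : A ∈ sortableTuples r a m (i + (r + 1))) (hB : B ∈ sortableTuples r (a + m) n j)
    (hA' : A' ∈ sortableTuples r a m' (i' + (r + 1))) (hB' : B' ∈ sortableTuples r (a + m') n' j')
    (hM : a + m ≤ M) (hM' : a + m' ≤ M)
    (h : A.take i ++ [M].intercalate (A.drop i) :: B =
      A'.take i' ++ [M].intercalate (A'.drop i') :: B') :
    i = i' ∧ j = j' ∧ m = m' ∧ n = n' ∧ A = A' ∧ B = B' := by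
  have notMem : ∀ {A : List (List ℕ)} {i m}, A ∈ sortableTuples r a m (i + (r + 1)) → a + m ≤ M →
      ∀ u ∈ A, M ∉ u := by
    intro A i m hA hM u hu hMu
    have := (mem_flatten_iff_of_S_eq hA.2.2 M).1 (List.mem_flatten.2 ⟨u, hu, hMu⟩)
    omega
  have len : ∀ {A : List (List ℕ)} {i m}, A ∈ sortableTuples r a m (i + (r + 1)) →
      (A.drop i).length = r + 1 := by
    intro A i m hA
    rw [List.length_drop, hA.1]
    omega
  have mem : ∀ {A : List (List ℕ)} {i m}, A ∈ sortableTuples r a m (i + (r + 1)) →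
      M ∈ [M].intercalate (A.drop i) := by
    intro A i m hA
    have := len hA
    exact (mem_intercalate_iff (by omega)).2 (Or.inr rfl)
  have split : ∀ {A : List (List ℕ)} {i m}, A ∈ sortableTuples r a m (i + (r + 1)) → a + m ≤ M →
      ([M].intercalate (A.drop i)).splitOn M = A.drop i := by
    intro A i m hA hM
    refine List.splitOn_intercalate M (fun l hl => notMem hA hM l (List.mem_of_mem_drop hl)) ?_
    intro h0
    have := len hA
    simp [h0] at this
  obtain ⟨h1, h2, rfl⟩ := append_cons_inj_of_forall (p := fun u => M ∈ u)
    (fun u hu => notMem hA hM u (List.mem_of_mem_take hu))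
    (fun u hu => notMem hA' hM' u (List.mem_of_mem_take hu)) (mem hA) (mem hA') h
  have h3 : A.drop i = A'.drop i' := by
    rw [← split hA hM, h2, split hA' hM']
  obtain rfl : A = A' := by
    rw [← List.take_append_drop i A, h1, h3, List.take_append_drop]
  have h4 : i = i' := by
    have h5 := hA.1
    have h6 := hA'.1
    omega
  have h5 : m = m' := by
    simpa using congrArg List.length (hA.2.2.symm.trans hA'.2.2)
  have h6 : n = n' := by
    simpa using congrArg List.length (hB.2.2.symm.trans hB'.2.2)
  exact ⟨h4, hB.1.symm.trans hB'.1, h5, h6, rfl, rfl⟩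

/-- The tuple obtained from two shorter ones by inserting the largest letter. -/
def glue (r a n k : ℕ) (hr : 1 ≤ r)
    (z : Σ q : ↥(antidiagonal k ×ˢ antidiagonal n),
      sortableTuples r a q.1.2.1 (q.1.1.1 + (r + 1)) ×
        sortableTuples r (a + q.1.2.1) q.1.2.2 q.1.1.2) :
    sortableTuples r a (n + 1) (k + 1) :=
  ⟨z.2.1.1.take z.1.1.1.1 ++ [a + n].intercalate (z.2.1.1.drop z.1.1.1.1) :: z.2.2.1, by
    obtain ⟨⟨⟨⟨i, j⟩, ⟨m, m'⟩⟩, hq⟩, ⟨A, hA⟩, ⟨B, hB⟩⟩ := z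
    simp only [mem_product, HasAntidiagonal.mem_antidiagonal] at hq
    obtain ⟨rfl, rfl⟩ := hq
    exact glue_mem_sortableTuples hr hA hB⟩

theorem glue_bijective (r a n k : ℕ) (hr : 1 ≤ r) : Function.Bijective (glue r a n k hr) := by
  constructor
  · rintro ⟨⟨⟨⟨i, j⟩, ⟨m, n₁⟩⟩, hq⟩, ⟨A, hA⟩, ⟨B, hB⟩⟩
      ⟨⟨⟨⟨i', j'⟩, ⟨m', n₁'⟩⟩, hq'⟩, ⟨A', hA'⟩, ⟨B', hB'⟩⟩ h
    have h0 := congrArg Subtype.val h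
    have hq1 := hq
    have hq1' := hq'
    simp only [mem_product, HasAntidiagonal.mem_antidiagonal] at hq1 hq1'
    obtain ⟨rfl, rfl, rfl, rfl, rfl, rfl⟩ :=
      glue_inj (M := a + n) hr hA hB hA' hB' (by dsimp only; omega) (by dsimp only; omega) h0
    rfl
  · rintro ⟨L, hL⟩
    obtain ⟨i, j, m, m', A, B, hij, hm, hA, hB, h⟩ := exists_glue_of_mem_sortableTuples hr hL
    exact ⟨⟨⟨⟨⟨i, j⟩, ⟨m, m'⟩⟩, by
      simp only [mem_product, HasAntidiagonal.mem_antidiagonal]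
      omega⟩, ⟨A, hA⟩, ⟨B, hB⟩⟩, Subtype.ext h⟩

theorem sortableTuples_zero_left (r a k : ℕ) :
    sortableTuples r a 0 k = {List.replicate k []} := by
  ext L
  rw [Set.mem_singleton_iff, List.eq_replicate_iff]
  constructor
  · rintro ⟨h1, -, h3⟩
    refine ⟨h1, fun u hu => List.eq_nil_iff_forall_not_mem.2 fun x hx => ?_⟩
    have := (mem_flatten_iff_of_S_eq h3 x).1 (List.mem_flatten.2 ⟨u, hu, hx⟩)
    omega
  · rintro ⟨h1, h2⟩
    have h3 : L.flatten = [] := List.flatten_eq_nil_iff.2 h2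
    refine ⟨h1, ⟨fun w hw => ?_, ?_, by simp [h3]⟩, ?_⟩
    · simp [h2 w hw, Nested]
    · refine List.pairwise_of_forall_mem_list fun u hu v _ => ?_
      simp [h2 u hu]
    · have h4 : (L.map S).flatten = [] := List.eq_nil_iff_forall_not_mem.2 fun x hx => by
        rw [mem_map_S_flatten_iff, h3] at hx
        simp at hx
      simp [h4, S_nil]

theorem sortableTuples_succ_zero (r a n : ℕ) : sortableTuples r a (n + 1) 0 = ∅ := by
  refine Set.eq_empty_of_forall_notMem fun L hL => ?_
  obtain ⟨h1, -, h3⟩ := hL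
  simp [List.length_eq_zero_iff.1 h1, S_nil, List.range'_succ] at h3

/-- Needed so that `Nat.card` is additive over the disjoint union in `glue`. The induction is on `n`
for all `k`, since the left factor may have a longer tuple. -/
theorem finite_sortableTuples {r : ℕ} (hr : 1 ≤ r) (n : ℕ) :
    ∀ a k, Finite (sortableTuples r a n k) := by
  induction n using Nat.strong_induction_on with
  | _ n ih =>
    intro a k
    match n, k with
    | 0, k => rw [sortableTuples_zero_left r a k]; infer_instance
    | n + 1, 0 => rw [sortableTuples_succ_zero]; infer_instance
    | n + 1, k + 1 =>
      have (q : ↥(antidiagonal k ×ˢ antidiagonal n)) :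
          Finite (sortableTuples r a q.1.2.1 (q.1.1.1 + (r + 1)) ×
            sortableTuples r (a + q.1.2.1) q.1.2.2 q.1.1.2) := by
        obtain ⟨⟨⟨i, j⟩, ⟨m, m'⟩⟩, hq⟩ := q
        simp only [mem_product, HasAntidiagonal.mem_antidiagonal] at hq
        have := ih m (by omega) a (i + (r + 1))
        have := ih m' (by omega) (a + m) j
        exact inferInstance
      exact Finite.of_surjective _ (glue_bijective r a n k hr).2

theorem card_sortableTuples_succ_succ {r : ℕ} (hr : 1 ≤ r) (a n k : ℕ) :
    Nat.card (sortableTuples r a (n + 1) (k + 1)) =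
      ∑ ij ∈ antidiagonal k, ∑ m ∈ antidiagonal n,
        Nat.card (sortableTuples r a m.1 (ij.1 + (r + 1))) *
          Nat.card (sortableTuples r (a + m.1) m.2 ij.2) := by
  have (n a k : ℕ) : Finite (sortableTuples r a n k) := finite_sortableTuples hr n a k
  rw [← Nat.card_eq_of_bijective _ (glue_bijective r a n k hr), Nat.card_sigma, ← sum_product',
    ← sum_coe_sort (antidiagonal k ×ˢ antidiagonal n)]
  simp only [Nat.card_prod]

/-- The right factor of the decomposition starts at `a + m`; this brings its count back to the
alphabet starting at `1`. -/
theorem card_sortableTuples_eq {r : ℕ} (hr : 1 ≤ r) (n : ℕ) :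
    ∀ a b k, Nat.card (sortableTuples r a n k) = Nat.card (sortableTuples r b n k) := by
  induction n using Nat.strong_induction_on with
  | _ n ih =>
    intro a b k
    match n, k with
    | 0, k => rw [sortableTuples_zero_left r a k, sortableTuples_zero_left r b k]
    | n + 1, 0 => rw [sortableTuples_succ_zero, sortableTuples_succ_zero]
    | n + 1, k + 1 =>
      rw [card_sortableTuples_succ_succ hr, card_sortableTuples_succ_succ hr]
      refine sum_congr rfl fun ij _ => sum_congr rfl fun m hm => ?_
      rw [HasAntidiagonal.mem_antidiagonal] at hm
      rw [ih m.1 (by omega) a b, ih m.2 (by omega) (a + m.1) (b + m.1)]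

/-- `S` preserves the set of letters, so the sorted output already forces the alphabet `[n]`; only
the multiplicity of the occurring letters remains to be prescribed. -/
theorem isTwoStackSortableTuple_iff (r n k : ℕ) (α : Fin k → List ℕ) :
    IsTwoStackSortableTuple r n k α ↔ List.ofFn α ∈ sortableTuples r 1 n k := by
  have hdis : (∀ (a : ℕ) (i j : Fin k), a ∈ α i → a ∈ α j → i = j) ↔
      (List.ofFn α).Pairwise List.Disjoint := by
    rw [List.pairwise_ofFn]
    constructor
    · intro h i j hij x hx hx'
      exact hij.ne (h x i j hx hx')
    · intro h x i j hx hx'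
      rcases lt_trichotomy i j with hij | hij | hij
      · exact absurd hx' (h hij hx)
      · exact hij
      · exact absurd hx (h hij hx')
  have hS : (List.ofFn fun i => S (α i)) = (List.ofFn α).map S := by
    rw [List.map_ofFn]; rfl
  rw [IsTwoStackSortableTuple, IsTupleRPerm, IsRPerm, hdis, hS, ← nested_iff_get, identityWord]
  generalize hL : List.ofFn α = L
  constructor
  · rintro ⟨⟨⟨h1, h2⟩, h3⟩, h4⟩
    refine ⟨by simp [← hL], ⟨(nested_flatten_iff h3).1 h2, h3, fun x hx => ?_⟩, h4⟩
    have := (mem_flatten_iff_of_S_eq h4 x).1 hx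
    rw [h1, if_pos (by rw [mem_Icc]; omega)]
  · rintro ⟨-, ⟨h2, h3, h1⟩, h4⟩
    refine ⟨⟨⟨fun x => ?_, (nested_flatten_iff h3).2 h2⟩, h3⟩, h4⟩
    have := mem_flatten_iff_of_S_eq h4 x
    split_ifs with hx
    · rw [mem_Icc] at hx
      exact h1 x (this.2 (by omega))
    · rw [mem_Icc] at hx
      exact List.count_eq_zero.2 fun h => hx (by have := this.1 h; omega)

theorem ncard_isTwoStackSortableTuple (r n k : ℕ) :
    {α | IsTwoStackSortableTuple r n k α}.ncard = Nat.card (sortableTuples r 1 n k) := by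
  rw [Nat.card_coe_set_eq, ← Set.ncard_image_of_injective _ (List.ofFn_injective (n := k))]
  congr 1
  ext L
  simp only [Set.mem_image, Set.mem_ofPred_eq, isTwoStackSortableTuple_iff]
  constructor
  · rintro ⟨α, h, rfl⟩
    exact h
  · intro h
    obtain rfl := h.1
    exact ⟨L.get, by rwa [List.ofFn_get], List.ofFn_get L⟩

theorem isTwoStackSortableTuple_one_iff (r n : ℕ) (α : Fin 1 → List ℕ) :
    IsTwoStackSortableTuple r n 1 α ↔ IsTwoStackSortable r n (α 0) := by
  rw [IsTwoStackSortableTuple, IsTupleRPerm, IsTwoStackSortable]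
  simp [Subsingleton.elim _ (0 : Fin 1)]

theorem ncard_isTwoStackSortableTuple_one (r n : ℕ) :
    {α | IsTwoStackSortableTuple r n 1 α}.ncard = {w | IsTwoStackSortable r n w}.ncard := by
  rw [← Set.ncard_image_of_injective _ (Equiv.funUnique (Fin 1) (List ℕ)).injective]
  congr 1
  ext w
  simp only [Set.mem_image, Set.mem_ofPred_eq, isTwoStackSortableTuple_one_iff]
  exact ⟨fun ⟨α, h, hw⟩ => hw ▸ h, fun h => ⟨fun _ => w, h, rfl⟩⟩

end Tuples

end StackSort

namespace StackSort

open PowerSeries Finset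

/-! ### Generating functions: the recursion, its uniqueness, and the series `y`. -/

section GeneratingFunction

theorem p_zero (r : ℕ) : p r 0 = 1 := by
  ext n
  rw [p, coeff_mk, ncard_isTwoStackSortableTuple, coeff_one]
  cases n with
  | zero => simp [sortableTuples_zero_left r 1 0]
  | succ n => simp [sortableTuples_succ_zero]

theorem p_succ (r : ℕ) (hr : 1 ≤ r) (k : ℕ) :
    p r (k + 1) = 1 + X * ∑ ij ∈ antidiagonal k, p r (ij.1 + (r + 1)) * p r ij.2 := by
  ext n
  rw [p, coeff_mk, ncard_isTwoStackSortableTuple, map_add, coeff_one]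
  cases n with
  | zero => simp [sortableTuples_zero_left r 1 (k + 1)]
  | succ n =>
    rw [coeff_succ_X_mul, map_sum, card_sortableTuples_succ_succ hr, if_neg (by omega), zero_add,
      Nat.cast_sum]
    refine sum_congr rfl fun ij _ => ?_
    rw [coeff_mul, Nat.cast_sum]
    refine sum_congr rfl fun m _ => ?_
    rw [p, p, coeff_mk, coeff_mk, ncard_isTwoStackSortableTuple, ncard_isTwoStackSortableTuple,
      Nat.cast_mul, card_sortableTuples_eq hr m.2 (1 + m.1) 1]

/-- The index `k` may grow on the right, but the factor `X` lowers the degree: induct on the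
coefficient, for all `k` together. -/
theorem eq_of_recursion {R : Type*} [CommRing R] {r : ℕ} {f g : ℕ → R⟦X⟧} (h0 : f 0 = g 0)
    (hf : ∀ k, f (k + 1) = 1 + X * ∑ ij ∈ antidiagonal k, f (ij.1 + (r + 1)) * f ij.2)
    (hg : ∀ k, g (k + 1) = 1 + X * ∑ ij ∈ antidiagonal k, g (ij.1 + (r + 1)) * g ij.2) :
    f = g := by
  have key : ∀ n k, coeff n (f k) = coeff n (g k) := by
    intro n
    induction n using Nat.strong_induction_on with
    | _ n ih =>
      intro k
      cases k with
      | zero => rw [h0]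
      | succ k =>
        rw [hf, hg, map_add, map_add]
        cases n with
        | zero => simp
        | succ n =>
          rw [coeff_succ_X_mul, coeff_succ_X_mul, map_sum, map_sum]
          congr 1
          refine sum_congr rfl fun ij _ => ?_
          rw [coeff_mul, coeff_mul]
          refine sum_congr rfl fun m hm => ?_
          rw [HasAntidiagonal.mem_antidiagonal] at hm
          rw [ih m.1 (by omega), ih m.2 (by omega)]
  funext k
  ext n
  exact key n k

theorem X_eq_mul_inv_iff {m : ℕ} {y : ℚ⟦X⟧} :
    X = y * ((1 + y) ^ m)⁻¹ ↔ constantCoeff y = 0 ∧ X * (1 + y) ^ m = y := by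
  constructor
  · intro h
    -- The inverse of a series with zero constant term is `0` by convention, which would give `X =
    -- 0`.
    have hne : constantCoeff ((1 + y) ^ m) ≠ 0 := by
      intro h0
      rw [PowerSeries.inv_eq_zero.2 h0, mul_zero] at h
      exact X_ne_zero h
    have h1 : X * (1 + y) ^ m = y := by
      rw [h, mul_assoc, PowerSeries.inv_mul_cancel _ hne, mul_one]
    refine ⟨?_, h1⟩
    rw [← h1]
    simp
  · rintro ⟨h0, h1⟩
    rw [PowerSeries.eq_mul_inv_iff_mul_eq (by simp [h0])]
    exact h1

theorem existsUnique_X_eq_mul_inv (m : ℕ) : ∃! y : ℚ⟦X⟧, X = y * ((1 + y) ^ m)⁻¹ := by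
  simp only [X_eq_mul_inv_iff]
  have hinv : ((1 + X : ℚ⟦X⟧) ^ m)⁻¹ * (1 + X) ^ m = 1 := PowerSeries.inv_mul_cancel _ (by simp)
  set F : ℚ⟦X⟧ := X * ((1 + X) ^ m)⁻¹ with hF
  have hF0 : constantCoeff F = 0 := by simp [hF]
  have hF1 : IsUnit (coeff 1 F) := by
    rw [hF, show (1 : ℕ) = 0 + 1 from rfl, coeff_succ_X_mul]
    simp
  -- Existence: `y` is the compositional inverse of `X / (1 + X)^m`.
  have hs := HasSubst.substInvOfIsUnit F hF1
  have hF : F * (1 + X) ^ m = X := by rw [hF, mul_assoc, hinv, mul_one]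
  have key := congrArg (substAlgHom hs) hF
  rw [map_mul, map_pow, map_add, map_one, coe_substAlgHom, subst_X hs,
    subst_substInvOfIsUnit_right F hF0] at key
  refine ⟨F.substInvOfIsUnit hF1, ⟨constantCoeff_substInvOfIsUnit F hF1, key⟩, ?_⟩
  rintro y ⟨-, hy⟩
  generalize F.substInvOfIsUnit hF1 = z at key
  -- Uniqueness: two solutions satisfy `(y - z)(1 - X q) = 0`, and the second factor has constant
  -- term `1`.
  obtain ⟨q, hq⟩ := sub_dvd_pow_sub_pow (1 + y) (1 + z) m
  have h : (y - z) * (1 - X * q) = 0 := by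
    linear_combination X * hq - hy + key
  rcases mul_eq_zero.1 h with h | h
  · exact sub_eq_zero.1 h
  · have := congrArg constantCoeff h
    simp at this

end GeneratingFunction

end StackSort

theorem mainTheorem10 (r : ℕ) (hr : 1 ≤ r) :
    StackSort.p r 1 =
      PowerSeries.mk (fun n => ({w | StackSort.IsTwoStackSortable r n w}.ncard : ℚ)) ∧
    (∃! y : PowerSeries ℚ, (PowerSeries.X : PowerSeries ℚ) = y * ((1 + y) ^ (2 * r + 1))⁻¹) ∧
    ∀ y : PowerSeries ℚ, (PowerSeries.X : PowerSeries ℚ) = y * ((1 + y) ^ (2 * r + 1))⁻¹ →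
      StackSort.p r 1 = 1 + y - (r : PowerSeries ℚ) * y ^ 2 := by
  refine ⟨?_, StackSort.existsUnique_X_eq_mul_inv _, fun y hy => ?_⟩
  · simp only [StackSort.p, StackSort.ncard_isTwoStackSortableTuple_one]
  · obtain ⟨h0, h1⟩ := StackSort.X_eq_mul_inv_iff.1 hy
    have hu : IsUnit (1 + y) := by
      rw [PowerSeries.isUnit_iff_constantCoeff]
      simp [h0]
    obtain ⟨f, hf0, hf1, hf⟩ := StackSort.exists_closed_form r _ y hu h1
    rw [← hf1, StackSort.eq_of_recursion ((StackSort.p_zero r).trans hf0.symm)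
      (StackSort.p_succ r hr) hf]
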